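/- Let $(X,T)$ be a minimal topological dynamical system ($X$ a compact metric space with metric $\rho$, $T:X\to X$ a homeomorphism, every orbit $\{T^nx:n\in\mathbb Z\}$ dense) and let $d\ge 1$ be an integer. Write $X^{[d]}=X^{\{0,1\}^d}$ and $\mathbf n\cdot\epsilon=\sum_{i}n_i\epsilon_i$ for $\mathbf n\in\mathbb Z^d$, $\epsilon\in\{0,1\}^d$. For any system $(Y,S)$ let $\mathbf Q^{[d]}(Y)$ be the closure in $Y^{[d]}$ of $\{(S^{\mathbf n\cdot\epsilon}y)_{\epsilon\in\{0,1\}^d}: y\in Y,\ \mathbf n\in\mathbb Z^d\}$. For $k\ge 0$ let $\mathbf{RP}^{[k]}(X)$ be the set of pairs $(x,y)\in X\times X$ such that for every $\delta>0$ there are $x',y'\in X$ and $\mathbf n\in\mathbb Z^k$ with $\rho(x,x')<\delta$, $\rho(y,y')<\delta$ and $\rho(T^{\mathbf n\cdot\epsilon}x',T^{\mathbf n\cdot\epsilon}y')<\delta$ for all $\epsilon\in\{0,1\}^k\setminus\{\mathbf 0\}$ (so $\mathbf{RP}^{[0]}(X)=X\times X$). Let $Z_{d-1}=X/\mathbf{RP}^{[d-1]}(X)$,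 with the quotient topology and the homeomorphism induced by $T$, be the maximal $(d-1)$-step pro-nilfactor of $(X,T)$ ($Z_0$ is trivial), let $\pi:X\to Z_{d-1}$ be the factor map, and let $\pi^{[d]}:X^{[d]}\to Z_{d-1}^{[d]}$ be the map that applies $\pi$ in every coordinate. Suppose that $\pi$ is a relatively incontractible (RIC) extension, that is, $\pi$ is open and for every $n\ge1$ the points of $R^n_\pi=\{(x_1,\dots,x_n)\in X^n:\pi(x_i)=\pi(x_j)\text{ for all }i,j\}$ that are minimal for $T\times\cdots\times T$ (those whose orbit closure is a minimal system) are dense in $R^n_\pi$. Then $$\mathbf Q^{[d]}(X)=(\pi^{[d]})^{-1}\,\mathbf Q^{[d]}(Z_{d-1}).$$ -/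

import Mathlib

namespace CubeDyn

/- A topological dynamical system is a compact metric space `X` with a homeomorphism `T : X ≃ₜ X`;
`T ^ n`, `n : ℤ`, is the iterate in the group of homeomorphisms of `X`. -/

section Basic

variable {X : Type*} [TopologicalSpace X]

/-- The orbit closure of `x` under `T`. -/
def orbitClosure (T : X ≃ₜ X) (x : X) : Set X :=
  closure (Set.range fun n : ℤ => (T ^ n) x)

/-- `(X, T)` is minimal: every orbit is dense. -/
def IsMinimalSystem (T : X ≃ₜ X) : Prop :=
  ∀ x : X, orbitClosure T x = Set.univ

/-- `x` is a minimal point: its orbit closure is a minimal subsystem. -/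
def IsMinimalPoint (T : X ≃ₜ X) (x : X) : Prop :=
  ∀ y ∈ orbitClosure T x, orbitClosure T y = orbitClosure T x

/-- The product homeomorphism `T × ⋯ × T` of `X ^ n`. -/
def prodHomeo (T : X ≃ₜ X) (n : ℕ) : (Fin n → X) ≃ₜ (Fin n → X) :=
  Homeomorph.piCongrRight fun _ => T

/-- The relation `R_π^n`: all coordinates lie in the same fibre of `π`. -/
def fibreRel {Y : Type*} (π : X → Y) (n : ℕ) : Set (Fin n → X) :=
  {x | ∀ i j, π (x i) = π (x j)}

/-- The extension `π` of minimal systems is relatively incontractible: it is open, and for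
every `n ≥ 1` the minimal points of `T × ⋯ × T` are dense in `R_π^n`. -/
structure IsRIC {Y : Type*} [TopologicalSpace Y] (T : X ≃ₜ X) (π : X → Y) : Prop where
  isOpenMap : IsOpenMap π
  dense_minimal : ∀ n : ℕ, 1 ≤ n →
    fibreRel π n ⊆ closure {x | x ∈ fibreRel π n ∧ IsMinimalPoint (prodHomeo T n) x}

end Basic

section Cubes

/-- The vertices `{0,1}^d` of the cube; `true` stands for `1` and `false` for `0`. -/
abbrev Vert (d : ℕ) : Type := Fin d → Bool

/-- `n · ε = ∑ nᵢ εᵢ`. -/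
def vdot {d : ℕ} (n : Fin d → ℤ) (ε : Vert d) : ℤ :=
  ∑ i, if ε i then n i else 0

/-- The set `Q^{[d]}(X)` of dynamical parallelepipeds of dimension `d`. -/
def parallelepipeds {X : Type*} [TopologicalSpace X] (T : X ≃ₜ X) (d : ℕ) : Set (Vert d → X) :=
  closure {p | ∃ (x : X) (n : Fin d → ℤ), p = fun ε => (T ^ vdot n ε) x}

/-- `φ^{[d]} : X^{[d]} → Y^{[d]}`, coordinatewise `φ`. -/
def cubeMap {X Y : Type*} (φ : X → Y) (d : ℕ) (p : Vert d → X) : Vert d → Y :=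
  fun ε => φ (p ε)

end Cubes

section ProNil

variable {X : Type*} [MetricSpace X]

/-- The regionally proximal relation `RP^{[d]}` of order `d`.
For `d = 0` the last condition is void, and the relation is all of `X × X`. -/
def RP (T : X ≃ₜ X) (d : ℕ) (x y : X) : Prop :=
  ∀ δ : ℝ, 0 < δ → ∃ (x' y' : X) (n : Fin d → ℤ), dist x x' < δ ∧ dist y y' < δ ∧
    ∀ ε : Vert d, ε ≠ (fun _ => false) →
      dist ((T ^ vdot n ε) x') ((T ^ vdot n ε) y') < δ

theorem RP.zpow [CompactSpace X] {T : X ≃ₜ X} {d : ℕ} {x y : X} (h : RP T d x y) (k : ℤ) :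
    RP T d ((T ^ k) x) ((T ^ k) y) := by
  intro δ hδ
  have huc : UniformContinuous (T ^ k : X ≃ₜ X) :=
    CompactSpace.uniformContinuous_of_continuous (T ^ k : X ≃ₜ X).continuous
  obtain ⟨η, hη, H⟩ := Metric.uniformContinuous_iff.1 huc δ hδ
  obtain ⟨x', y', n, h1, h2, h3⟩ := h η hη
  refine ⟨(T ^ k) x', (T ^ k) y', n, H h1, H h2, fun ε hε => ?_⟩
  have hc : ∀ z : X, (T ^ vdot n ε) ((T ^ k) z) = (T ^ k) ((T ^ vdot n ε) z) := fun z => by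
    rw [← Homeomorph.mul_apply, ← Homeomorph.mul_apply, zpow_mul_comm]
  rw [hc, hc]
  exact H (h3 ε hε)

variable (T : X ≃ₜ X) (d : ℕ)

/-- The maximal `d`-step pro-nilfactor `Z_d = X / RP^{[d]}`, with the quotient topology. (`Quot`
divides by the equivalence relation generated by `RP^{[d]}`, so no property of the relation
is presupposed.) -/
def ProNilFactor : Type _ := Quot (RP T d)

instance : TopologicalSpace (ProNilFactor T d) :=
  inferInstanceAs (TopologicalSpace (Quot (RP T d)))

/-- The factor map `π_d : X → Z_d`. -/
def proNilMap (x : X) : ProNilFactor T d := Quot.mk _ x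

/-- The homeomorphism of `Z_d` induced by `T`. -/
def proNilHomeo [CompactSpace X] : ProNilFactor T d ≃ₜ ProNilFactor T d where
  toFun := Quot.map T fun _ _ h => by simpa using h.zpow 1
  invFun := Quot.map T.symm fun _ _ h => by simpa using h.zpow (-1)
  left_inv := by rintro ⟨x⟩; exact congrArg (Quot.mk _) (T.symm_apply_apply x)
  right_inv := by rintro ⟨x⟩; exact congrArg (Quot.mk _) (T.apply_symm_apply x)
  continuous_toFun := continuous_quot_lift _ (continuous_quot_mk.comp T.continuous)
  continuous_invFun := continuous_quot_lift _ (continuous_quot_mk.comp T.symm.continuous)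

/-- `π_d` is a factor map from `(X, T)` to `Z_d`. -/
theorem proNilMap_isFactorMap [CompactSpace X] :
    Continuous (proNilMap T d) ∧ Function.Surjective (proNilMap T d) ∧
      ∀ x, proNilMap T d (T x) = proNilHomeo T d (proNilMap T d x) :=
  ⟨continuous_quot_mk, Quot.mk_surjective, fun _ => rfl⟩

end ProNil

end CubeDyn

/-! Write d + 1 for the dimension, so that the factor is Z_d. Since π is open, the preimage of the
closure of the cubes (S^(n·ε) y) is the closure of their preimage, and a face transformation moves a
point of that preimage to one with all coordinates in a single fibre. It remains to show that such a
point p lies in Q^[d+1](X); by RIC, p may be taken from a minimal point z of a power of T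
(`comp_mem_parallelepipeds_of_isMinimalPoint`).

Start from a constant cube and change one vertex at a time, along pairs in RP^[d]. Minimality of z
gives freedom of base point: z can be moved in its orbit closure until the vertex in question
carries any prescribed x, and moved back afterwards. Choose x generic (`exists_isGoodBase`), so that
each parallelepiped q with q_0 = x is a limit of cubes (T^(n·ε) x). Face transformations fix the
vertex 0, so replacing q_0 by y is possible as soon as (y, x, ..., x) is a parallelepiped
(`RP.update_zero_mem`).

For that, a pair (x, y) in RP^[d] yields w in Q^[d](X) with w_0 = x such that w and its modification
by y at 0 are opposite faces of a parallelepiped. By genericity w lies in the face orbit closure of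
the constant cube x. That closure is minimal, by an argument with idempotents of the Ellis semigroup
(`const_mem_faceOrbitClosure`), so w can be pushed back to the constant cube. -/

namespace CubeDyn

open Set Topology Filter

/-! ### Orbit closures and minimal points. -/

section OrbitClosures

variable {X : Type*} [TopologicalSpace X] {T : X ≃ₜ X}

theorem zpow_apply_zpow_apply (T : X ≃ₜ X) (m n : ℤ) (x : X) :
    (T ^ m) ((T ^ n) x) = (T ^ (m + n)) x := by
  rw [zpow_add, Homeomorph.mul_apply]

theorem zpow_mem_orbitClosure (T : X ≃ₜ X) (n : ℤ) (x : X) : (T ^ n) x ∈ orbitClosure T x :=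
  subset_closure ⟨n, rfl⟩

theorem self_mem_orbitClosure (T : X ≃ₜ X) (x : X) : x ∈ orbitClosure T x := by
  simpa using zpow_mem_orbitClosure T 0 x

theorem orbitClosure_subset {S : Set X} (hS : IsClosed S)
    (hinv : ∀ y ∈ S, ∀ n : ℤ, (T ^ n) y ∈ S) {x : X} (hx : x ∈ S) : orbitClosure T x ⊆ S :=
  closure_minimal (by rintro _ ⟨n, rfl⟩; exact hinv x hx n) hS

theorem zpow_mem_orbitClosure_of_mem {x y : X} (hy : y ∈ orbitClosure T x) (n : ℤ) :
    (T ^ n) y ∈ orbitClosure T x := by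
  refine map_mem_closure (T ^ n : X ≃ₜ X).continuous hy ?_
  rintro _ ⟨m, rfl⟩
  exact ⟨n + m, (zpow_apply_zpow_apply T n m x).symm⟩

theorem orbitClosure_subset_of_mem {x y : X} (hy : y ∈ orbitClosure T x) :
    orbitClosure T y ⊆ orbitClosure T x :=
  orbitClosure_subset isClosed_closure (fun _ hz n => zpow_mem_orbitClosure_of_mem hz n) hy

theorem IsMinimalPoint.of_mem {x y : X} (hx : IsMinimalPoint T x) (hy : y ∈ orbitClosure T x) :
    IsMinimalPoint T y := by
  intro z hz
  rw [hx y hy] at hz ⊢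
  exact hx z hz

theorem IsMinimalPoint.mem_symm {x y : X} (hx : IsMinimalPoint T x)
    (hy : y ∈ orbitClosure T x) : x ∈ orbitClosure T y :=
  (hx y hy).symm ▸ self_mem_orbitClosure T x

/-- Every orbit closure in a compact system contains a minimal point. -/
theorem exists_isMinimalPoint_mem [CompactSpace X] (T : X ≃ₜ X) (x : X) :
    ∃ y ∈ orbitClosure T x, IsMinimalPoint T y := by
  -- Zorn: `M` is a minimal nonempty closed invariant set.
  obtain ⟨M, hMx, ⟨hMc, ⟨y, hy⟩, hMinv⟩, hM⟩ := zorn_superset_nonempty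
    {S : Set X | IsClosed S ∧ S.Nonempty ∧ ∀ y ∈ S, ∀ n : ℤ, (T ^ n) y ∈ S}
    (fun c hc hchain hne => by
      refine ⟨⋂₀ c, ⟨isClosed_sInter fun s hs => (hc hs).1, ?_, ?_⟩,
        fun s hs => sInter_subset_of_mem hs⟩
      · have := hne.to_subtype
        exact IsCompact.nonempty_sInter_of_directed_nonempty_isCompact_isClosed 
          (fun a ha b hb => (hchain.total ha hb).elim (fun h => ⟨a, ha, subset_rfl, h⟩)
            fun h => ⟨b, hb, h, subset_rfl⟩)
          (fun s hs => (hc hs).2.1)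
          (fun s hs => (hc hs).1.isCompact) (fun s hs => (hc hs).1)
      · intro y hy n s hs
        exact (hc hs).2.2 y (hy s hs) n)
    (orbitClosure T x) ⟨isClosed_closure, ⟨x, self_mem_orbitClosure T x⟩,
      fun _ hz n => zpow_mem_orbitClosure_of_mem hz n⟩
  have key : ∀ z ∈ M, orbitClosure T z = M := fun z hz => by
    have hsub := orbitClosure_subset hMc hMinv hz
    exact hsub.antisymm (hM ⟨isClosed_closure, ⟨z, self_mem_orbitClosure T z⟩,
      fun _ hw n => zpow_mem_orbitClosure_of_mem hw n⟩ hsub)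
  refine ⟨y, hMx hy, fun z hz => ?_⟩
  rw [key y hy] at hz ⊢
  exact key z hz

end OrbitClosures

/-- The diagonal homeomorphism of `X ^ J`. -/
def diagHomeo {X : Type*} [TopologicalSpace X] (T : X ≃ₜ X) (J : Type*) : (J → X) ≃ₜ (J → X) :=
  Homeomorph.piCongrRight fun _ => T

/-! ### Diagonal action on powers of X. -/

section Diagonal

variable {X : Type*} [TopologicalSpace X] {T : X ≃ₜ X}

theorem diagHomeo_zpow_apply (T : X ≃ₜ X) {J : Type*} (n : ℤ) (z : J → X) :
    (diagHomeo T J ^ n) z = fun j => (T ^ n) (z j) := by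
  induction n using Int.induction_on generalizing z with
  | zero => rfl
  | succ k ih =>
    rw [add_comm, zpow_add, zpow_add, Homeomorph.mul_apply, ih]
    rfl
  | pred k ih =>
    rw [sub_eq_add_neg, add_comm, zpow_add, zpow_add, Homeomorph.mul_apply, ih]
    rfl

theorem comp_mem_orbitClosure {J K : Type*} {z z' : J → X}
    (hz : z' ∈ orbitClosure (diagHomeo T J) z) (i : K → J) :
    z' ∘ i ∈ orbitClosure (diagHomeo T K) (z ∘ i) := by
  refine map_mem_closure (f := fun w : J → X => w ∘ i) (by fun_prop) hz ?_
  rintro _ ⟨n, rfl⟩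
  exact ⟨n, by simp only [diagHomeo_zpow_apply]; rfl⟩

/-- A factor map carries orbit closures onto orbit closures, here for a coordinate of `X ^ J`. -/
theorem exists_mem_orbitClosure_apply [CompactSpace X] [T2Space X] {J : Type*} (z : J → X) (j : J)
    {x : X} (hx : x ∈ orbitClosure T (z j)) :
    ∃ z' ∈ orbitClosure (diagHomeo T J) z, z' j = x := by
  have hK : IsClosed ((fun w : J → X => w j) '' orbitClosure (diagHomeo T J) z) :=
    (isClosed_closure.isCompact.image (by fun_prop)).isClosed
  refine orbitClosure_subset (T := T) hK ?_ ⟨z, self_mem_orbitClosure _ z, rfl⟩ hx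
  rintro _ ⟨w, hw, rfl⟩ n
  exact ⟨_, zpow_mem_orbitClosure_of_mem hw n, by simp only [diagHomeo_zpow_apply]⟩

/-- A minimal point of `X ^ J` together with an arbitrary point of `X ^ K` can be replaced, within
the joint orbit closure, by a jointly minimal point with the same first component. -/
theorem exists_isMinimalPoint_sumElim [CompactSpace X] [T2Space X] {J K : Type*} {z : J → X}
    (hz : IsMinimalPoint (diagHomeo T J) z) (c : K → X) :
    ∃ w ∈ orbitClosure (diagHomeo T (J ⊕ K)) (Sum.elim z c),
      IsMinimalPoint (diagHomeo T (J ⊕ K)) w ∧ w ∘ Sum.inl = z := by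
  obtain ⟨m, hm, hmin⟩ := exists_isMinimalPoint_mem (diagHomeo T (J ⊕ K)) (Sum.elim z c)
  have h1 : m ∘ Sum.inl ∈ orbitClosure (diagHomeo T J) z := by
    simpa using comp_mem_orbitClosure hm Sum.inl
  have hK : IsClosed ((fun w : J ⊕ K → X => w ∘ Sum.inl) '' orbitClosure (diagHomeo T (J ⊕ K)) m) :=
    (isClosed_closure.isCompact.image (by fun_prop)).isClosed
  have h2 : z ∈ (fun w : J ⊕ K → X => w ∘ Sum.inl) '' orbitClosure (diagHomeo T (J ⊕ K)) m := by
    refine orbitClosure_subset (T := diagHomeo T J) hK ?_ ⟨m, self_mem_orbitClosure _ m, rfl⟩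
      (hz.mem_symm h1)
    rintro _ ⟨w, hw, rfl⟩ n
    exact ⟨_, zpow_mem_orbitClosure_of_mem hw n, by simp only [diagHomeo_zpow_apply]; rfl⟩
  obtain ⟨w, hw, rfl⟩ := h2
  exact ⟨w, orbitClosure_subset_of_mem hm hw, hmin.of_mem hw, rfl⟩

end Diagonal

/-! ### The Ellis semigroup and minimal idempotents. -/

section Ellis

variable {X : Type*} [TopologicalSpace X] {T : X ≃ₜ X}

/-- The topology of pointwise convergence on the monoid of self-maps of `X`. -/
instance endTopology : TopologicalSpace (Function.End X) :=
  inferInstanceAs (TopologicalSpace (X → X))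

instance [T2Space X] : T2Space (Function.End X) := inferInstanceAs (T2Space (X → X))

instance [CompactSpace X] : CompactSpace (Function.End X) :=
  inferInstanceAs (CompactSpace (X → X))

theorem end_continuous_mul_const (r : Function.End X) : Continuous (· * r) :=
  continuous_pi fun x => continuous_apply (A := fun _ : X => X) (r x)

/-- The Ellis semigroup of `(X, T)`. -/
def ellis (T : X ≃ₜ X) : Set (Function.End X) := orbitClosure (diagHomeo T X) (id : X → X)

/-- The Ellis semigroup acts transitively on orbit closures in powers of `X`. -/
theorem exists_ellis_comp_eq [CompactSpace X] [T2Space X] {J : Type*} {z w : J → X}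
    (hw : w ∈ orbitClosure (diagHomeo T J) z) : ∃ e ∈ ellis T, w = e ∘ z := by
  have hK : IsClosed ((fun e : X → X => e ∘ z) '' orbitClosure (diagHomeo T X) id) :=
    (isClosed_closure.isCompact.image (by fun_prop)).isClosed
  obtain ⟨e, he, h⟩ := orbitClosure_subset (T := diagHomeo T J) hK (by
    rintro _ ⟨w, hw, rfl⟩ n
    exact ⟨_, zpow_mem_orbitClosure_of_mem hw n, by simp only [diagHomeo_zpow_apply]; rfl⟩)
    ⟨id, self_mem_orbitClosure _ _, rfl⟩ hw
  exact ⟨e, he, h.symm⟩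

theorem ellis_comp_mem {e : Function.End X} (he : e ∈ ellis T) {J : Type*} (z : J → X) :
    e ∘ z ∈ orbitClosure (diagHomeo T J) z :=
  comp_mem_orbitClosure (T := T) (z := id) he z

/-- Every point of a minimal system is fixed by an idempotent of the Ellis semigroup that belongs
to a minimal left ideal; the last clause expresses the latter. -/
theorem exists_minimal_idempotent [CompactSpace X] [T2Space X] (hT : IsMinimalSystem T) (x : X) :
    ∃ u ∈ ellis T, u * u = u ∧ u x = x ∧ ∀ v ∈ ellis T, v * v = v → v * u = v → u * v = u := by
  obtain ⟨l, hl, hmin⟩ := exists_isMinimalPoint_mem (diagHomeo T X) (id : X → X)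
  have hLE : orbitClosure (diagHomeo T X) l ⊆ ellis T := orbitClosure_subset_of_mem hl
  have hmul : ∀ p ∈ ellis T, ∀ m ∈ orbitClosure (diagHomeo T X) l,
      p ∘ m ∈ orbitClosure (diagHomeo T X) l := fun p hp m hm =>
    orbitClosure_subset_of_mem hm (ellis_comp_mem hp m)
  obtain ⟨m, hm, hmx⟩ := exists_mem_orbitClosure_apply (T := T) l x (x := x)
    (by rw [hT]; trivial)
  -- The orbit closure of `l` is a minimal left ideal; its elements fixing `x` form a nonempty
  -- compact subsemigroup, which contains an idempotent.
  let S : Set (Function.End X) := {p | p ∈ orbitClosure (diagHomeo T X) l ∧ p x = x}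
  have hS : IsClosed S := by
    have h1 : IsClosed {p : X → X | p ∈ orbitClosure (diagHomeo T X) l} := isClosed_closure
    have h2 : IsClosed {p : X → X | p x = x} :=
      isClosed_eq (continuous_apply x) continuous_const
    exact h1.inter h2
  obtain ⟨u, ⟨huL, hux⟩, huu⟩ := exists_idempotent_in_compact_subsemigroup
    end_continuous_mul_const S ⟨m, hm, hmx⟩ hS.isCompact (by
      rintro p ⟨hp, hpx⟩ q ⟨hq, hqx⟩
      refine ⟨hmul p (hLE hp) q hq, ?_⟩
      change p (q x) = x
      rw [hqx, hpx])
  refine ⟨u, hLE huL, huu, hux, fun v hv hvv hvu => ?_⟩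
  have hvL : v ∈ orbitClosure (diagHomeo T X) l := by
    rw [← hvu]; exact hmul v hv u huL
  -- By minimality `v` generates the same ideal, so u = e v and u v = e v v = e v = u.
  obtain ⟨e, -, he⟩ := exists_ellis_comp_eq (T := T) (z := v) (w := u)
    (by rw [hmin v hvL]; exact huL)
  have he' : u = e * v := he
  rw [he', mul_assoc, hvv]

end Ellis

/-! ### Face transformations and minimality of face orbit closures. -/

section FaceGroup

variable {X : Type*} [TopologicalSpace X] {T : X ≃ₜ X} {d : ℕ}

@[simp] theorem vdot_zero_right (n : Fin d → ℤ) : vdot n (fun _ => false) = 0 := by simp [vdot]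

@[simp] theorem vdot_zero_left (ε : Vert d) : vdot 0 ε = 0 := by simp [vdot]

theorem vdot_add (m n : Fin d → ℤ) (ε : Vert d) : vdot (m + n) ε = vdot m ε + vdot n ε := by
  simp only [vdot, Pi.add_apply, ← Finset.sum_add_distrib]
  exact Finset.sum_congr rfl fun i _ => by split_ifs <;> simp

theorem vdot_single (j : Fin d) (k : ℤ) (ε : Vert d) :
    vdot (Pi.single j k) ε = if ε j then k else 0 := by
  rw [vdot, Finset.sum_eq_single j]
  · simp
  · intro i _ hi
    simp [hi]
  · simp

/-- The orbit closure of a cube under the face transformations that fix the vertex `0`. -/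
def faceOrbitClosure (T : X ≃ₜ X) (r : Vert d → X) : Set (Vert d → X) :=
  closure (range fun (n : Fin d → ℤ) (ε : Vert d) => (T ^ vdot n ε) (r ε))

/-- The face transformation `(T ^ (n · ε))_ε`. -/
def faceMap (T : X ≃ₜ X) (n : Fin d → ℤ) : Vert d → Function.End X :=
  fun ε => ⇑(T ^ vdot n ε)

/-- The Ellis semigroup of the face transformations, inside the product of self-maps. -/
def faceEllis (T : X ≃ₜ X) (d : ℕ) : Set (Vert d → Function.End X) :=
  closure (range fun n : Fin d → ℤ => faceMap T n)

theorem pi_end_continuous_mul_const (r : Vert d → Function.End X) : Continuous (· * r) :=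
  continuous_pi fun ε => (end_continuous_mul_const (r ε)).comp (continuous_apply ε)

theorem faceEllis_one_mem : (1 : Vert d → Function.End X) ∈ faceEllis T d :=
  subset_closure ⟨0, by
    funext ε
    simp only [faceMap, vdot_zero_left, zpow_zero]
    rfl⟩

/-- Multiplication is continuous in the left factor only, whereas left multiplication by a
homeomorphism is continuous. Hence two limits: first in `g`, with a face transformation on the left,
then in `f`. -/
theorem faceEllis_mul_mem {f g : Vert d → Function.End X} (hf : f ∈ faceEllis T d)
    (hg : g ∈ faceEllis T d) : f * g ∈ faceEllis T d := by
  have key : ∀ n : Fin d → ℤ, faceMap T n * g ∈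
      faceEllis T d := fun n => by
    refine map_mem_closure (f := fun h : Vert d → Function.End X =>
      faceMap T n * h) ?_ hg ?_
    · refine continuous_pi fun ε => continuous_pi (A := fun _ : X => X) fun x => ?_
      exact (T ^ vdot n ε).continuous.comp
        ((continuous_apply (A := fun _ : X => X) x).comp
          (continuous_apply (A := fun _ : Vert d => Function.End X) ε))
    · rintro _ ⟨m, rfl⟩
      refine ⟨n + m, ?_⟩
      funext ε
      simp only [faceMap, vdot_add, zpow_add]
      rfl
  have : f * g ∈ closure (faceEllis T d) := by
    refine map_mem_closure (f := fun h => h * g) (pi_end_continuous_mul_const g) hf ?_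
    rintro _ ⟨n, rfl⟩
    exact key n
  rwa [faceEllis, closure_closure] at this

theorem faceEllis_apply_mem {f : Vert d → Function.End X} (hf : f ∈ faceEllis T d) (ε : Vert d) :
    f ε ∈ ellis T := by
  refine map_mem_closure (f := fun h : Vert d → Function.End X => h ε) (continuous_apply ε) hf ?_
  rintro _ ⟨n, rfl⟩
  exact ⟨vdot n ε, diagHomeo_zpow_apply T _ _⟩

theorem faceEllis_apply_zero [T2Space X] {f : Vert d → Function.End X} (hf : f ∈ faceEllis T d) :
    f (fun _ => false) = 1 := by
  have hK : IsClosed {h : Vert d → Function.End X | h (fun _ => false) = 1} :=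
    isClosed_eq (continuous_apply _) continuous_const
  refine closure_minimal ?_ hK hf
  rintro _ ⟨n, rfl⟩
  have : faceMap T n (fun _ => false) = 1 := by
    simp only [faceMap, vdot_zero_right, zpow_zero]
    rfl
  exact this

theorem ellis_direction_mem {p : Function.End X} (hp : p ∈ ellis T) (j : Fin d) :
    (fun ε : Vert d => if ε j then p else 1) ∈ faceEllis T d := by
  refine map_mem_closure (f := fun (q : Function.End X) (ε : Vert d) => if ε j then q else 1)
    (continuous_pi fun ε => ?_) hp ?_
  · split_ifs
    exacts [continuous_id, continuous_const]
  · rintro _ ⟨n, rfl⟩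
    refine ⟨Pi.single j n, ?_⟩
    funext ε
    simp only [faceMap, vdot_single]
    split_ifs
    · exact (diagHomeo_zpow_apply T n id).symm
    · rfl

/-- An idempotent of the Ellis semigroup, placed at every vertex other than `0`, is a limit of
face transformations. -/
theorem ellis_idempotent_mem_faceEllis {u : Function.End X} (hu : u ∈ ellis T) (huu : u * u = u) :
    (fun ε : Vert d => if ε = fun _ => false then 1 else u) ∈ faceEllis T d := by
  have key : ∀ s : Finset (Fin d),
      (fun ε : Vert d => if ∃ j ∈ s, ε j = true then u else 1) ∈ faceEllis T d := fun s => by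
    induction s using Finset.induction_on with
    | empty => simpa using! faceEllis_one_mem
    | insert j s _ ih =>
      -- The new factor puts `u` on the face ε_j = 1; where `u` already stood, u u = u.
      convert faceEllis_mul_mem (ellis_direction_mem hu j) ih using 1
      funext ε
      by_cases h1 : ε j = true <;> by_cases h2 : ∃ i ∈ s, ε i = true <;>
        simp [h1, h2, huu]
  convert key Finset.univ using 1
  funext ε
  by_cases h : ε = fun _ => false
  · simp [h]
  · have : ∃ j ∈ Finset.univ, ε j = true := by
      by_contra! hc
      exact h (funext fun j => by simpa using hc j (Finset.mem_univ j))
    rw [if_neg h, if_pos this]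

theorem faceEllis_act_mem {f : Vert d → Function.End X} (hf : f ∈ faceEllis T d)
    (r : Vert d → X) : (fun ε => f ε (r ε)) ∈ faceOrbitClosure T r := by
  refine map_mem_closure (f := fun (h : Vert d → Function.End X) (ε : Vert d) => h ε (r ε))
    (continuous_pi fun ε =>
      (continuous_apply (A := fun _ : X => X) (r ε)).comp (continuous_apply ε)) hf ?_
  rintro _ ⟨n, rfl⟩
  exact ⟨n, rfl⟩

theorem exists_faceEllis_act_eq [CompactSpace X] [T2Space X] {r s : Vert d → X}
    (hs : s ∈ faceOrbitClosure T r) : ∃ f ∈ faceEllis T d, s = fun ε => f ε (r ε) := by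
  have hK : IsClosed ((fun (h : Vert d → Function.End X) (ε : Vert d) => h ε (r ε)) ''
      faceEllis T d) :=
    (isClosed_closure.isCompact.image (continuous_pi fun ε =>
      (continuous_apply (A := fun _ : X => X) (r ε)).comp (continuous_apply ε))).isClosed
  obtain ⟨f, hf, h⟩ := closure_minimal (by
    rintro _ ⟨n, rfl⟩
    exact ⟨_, subset_closure ⟨n, rfl⟩, rfl⟩) hK hs
  exact ⟨f, hf, h.symm⟩

/-- The face orbit closure of a constant cube over a minimal system is minimal. -/
theorem const_mem_faceOrbitClosure [CompactSpace X] [T2Space X] (hT : IsMinimalSystem T) (x : X)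
    {r : Vert d → X} (hr : r ∈ faceOrbitClosure T fun _ => x) :
    (fun _ => x) ∈ faceOrbitClosure T r := by
  obtain ⟨u, hu, huu, hux, hmin⟩ := exists_minimal_idempotent hT x
  obtain ⟨f, hf, rfl⟩ := exists_faceEllis_act_eq hr
  set U : Vert d → Function.End X := fun ε => if ε = fun _ => false then 1 else u with hU
  have hUm : U ∈ faceEllis T d := ellis_idempotent_mem_faceEllis hu huu
  have hUU : U * U = U := by
    funext ε
    by_cases h : ε = fun _ => false <;> simp [hU, h, huu]
  have hUx : ∀ ε, U ε x = x := fun ε => by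
    by_cases h : ε = fun _ => false
    · simp only [hU, h, if_true]; rfl
    · simp only [hU, h, if_false]; exact hux
  -- An idempotent v = g f U of the left ideal generated by f U. It satisfies v U = v, so minimality
  -- of `u` gives U v = U, and U g sends r = f x back to x.
  obtain ⟨v, ⟨g, hg, rfl⟩, hvv⟩ := exists_idempotent_in_compact_subsemigroup
    pi_end_continuous_mul_const ((fun g => g * (f * U)) '' faceEllis T d)
    ⟨_, 1, faceEllis_one_mem, rfl⟩
    (isClosed_closure.isCompact.image (pi_end_continuous_mul_const _)) (by
      rintro _ ⟨g, hg, rfl⟩ _ ⟨g', hg', rfl⟩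
      exact ⟨g * (f * U) * g', faceEllis_mul_mem
        (faceEllis_mul_mem hg (faceEllis_mul_mem hf hUm)) hg', mul_assoc _ _ _⟩)
  set v := g * (f * U) with hv
  have hvm : v ∈ faceEllis T d := faceEllis_mul_mem hg (faceEllis_mul_mem hf hUm)
  have hvU : v * U = v := by rw [hv, mul_assoc, mul_assoc, hUU]
  have hUv : U * v = U := by
    funext ε
    by_cases h : ε = fun _ => false
    · subst h
      rw [Pi.mul_apply, faceEllis_apply_zero hvm, mul_one]
    · have hUε : U ε = u := by simp only [hU, h, if_false]
      have h1 : v ε * U ε = v ε := congrFun hvU ε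
      have h2 : v ε * v ε = v ε := congrFun hvv ε
      rw [hUε] at h1
      rw [Pi.mul_apply, hUε]
      exact hmin (v ε) (faceEllis_apply_mem hvm ε) h2 h1
  have h3 := faceEllis_act_mem (faceEllis_mul_mem hUm hg) fun ε => f ε x
  convert h3 using 1
  funext ε
  have h4 : (U * v) ε x = x := by rw [hUv, hUx]
  have h5 : (U * v) ε x = U ε (g ε (f ε (U ε x))) := rfl
  rw [h5, hUx] at h4
  exact h4.symm

end FaceGroup

/-! ### Symmetries of the set of parallelepipeds. -/

section Parallelepipeds

variable {X : Type*} [TopologicalSpace X] {T : X ≃ₜ X} {d : ℕ}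

theorem isClosed_parallelepipeds : IsClosed (parallelepipeds T d) := isClosed_closure

theorem cube_mem_parallelepipeds (T : X ≃ₜ X) (x : X) (n : Fin d → ℤ) :
    (fun ε => (T ^ vdot n ε) x) ∈ parallelepipeds T d :=
  subset_closure ⟨x, n, rfl⟩

theorem const_mem_parallelepipeds (T : X ≃ₜ X) (x : X) :
    (fun _ => x) ∈ parallelepipeds T d := by
  simpa using cube_mem_parallelepipeds T x (0 : Fin d → ℤ)

theorem parallelepipeds_shift {p : Vert d → X} (hp : p ∈ parallelepipeds T d) (c : ℤ)
    (m : Fin d → ℤ) : (fun ε => (T ^ (c + vdot m ε)) (p ε)) ∈ parallelepipeds T d := by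
  refine map_mem_closure (f := fun (q : Vert d → X) (ε : Vert d) => (T ^ (c + vdot m ε)) (q ε))
    (continuous_pi fun ε => (T ^ (c + vdot m ε)).continuous.comp (continuous_apply ε)) hp ?_
  rintro _ ⟨x, n, rfl⟩
  refine ⟨(T ^ c) x, m + n, ?_⟩
  funext ε
  simp only [zpow_apply_zpow_apply, vdot_add]
  congr 2
  ring

theorem parallelepipeds_face {p : Vert d → X} (hp : p ∈ parallelepipeds T d)
    (m : Fin d → ℤ) : (fun ε => (T ^ vdot m ε) (p ε)) ∈ parallelepipeds T d := by
  simpa using parallelepipeds_shift hp 0 m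

theorem parallelepipeds_diag {p : Vert d → X} (hp : p ∈ parallelepipeds T d) (c : ℤ) :
    (fun ε => (T ^ c) (p ε)) ∈ parallelepipeds T d := by
  simpa using parallelepipeds_shift hp c 0

theorem vdot_xor (n : Fin d → ℤ) (ε ω : Vert d) :
    vdot n (fun i => xor (ε i) (ω i)) = vdot (fun i => if ω i then -n i else n i) ε + vdot n ω := by
  simp only [vdot, ← Finset.sum_add_distrib]
  refine Finset.sum_congr rfl fun i _ => ?_
  by_cases h1 : ε i = true <;> by_cases h2 : ω i = true <;> simp [h1, h2]

/-- The reflections of the cube preserve the set of parallelepipeds. -/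
theorem parallelepipeds_xor {p : Vert d → X} (hp : p ∈ parallelepipeds T d) (ω : Vert d) :
    (fun ε => p fun i => xor (ε i) (ω i)) ∈ parallelepipeds T d := by
  refine map_mem_closure (f := fun (q : Vert d → X) (ε : Vert d) => q fun i => xor (ε i) (ω i))
    (by fun_prop) hp ?_
  rintro _ ⟨x, n, rfl⟩
  refine ⟨(T ^ vdot n ω) x, fun i => if ω i then -n i else n i, ?_⟩
  funext ε
  simp only [zpow_apply_zpow_apply, vdot_xor]

theorem xor_eq_zero_iff (ε ω : Vert d) : (fun i => xor (ε i) (ω i)) = (fun _ => false) ↔ ε = ω := by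
  constructor
  · intro h
    funext i
    have := congrFun h i
    revert this
    cases ε i <;> cases ω i <;> simp
  · rintro rfl
    simp

end Parallelepipeds

/-! ### Generic base points. -/

section GoodBase

variable {X : Type*} [TopologicalSpace X]

/-- Every parallelepiped with base point `x` is a limit of parallelepipeds `(T ^ (n · ε) x)_ε`. -/
def IsGoodBase (T : X ≃ₜ X) (d : ℕ) (x : X) : Prop :=
  ∀ q ∈ parallelepipeds T d, q (fun _ => false) = x → q ∈ faceOrbitClosure T fun _ => x

/-- By Baire's theorem there is a base point that is good in every dimension. -/
theorem exists_isGoodBase [SecondCountableTopology X] [BaireSpace X] [Nonempty X] (T : X ≃ₜ X) :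
    ∃ x, ∀ d, IsGoodBase T d x := by
  let U : (Σ d, TopologicalSpace.countableBasis (Vert d → X)) → Set X := fun V =>
    ⋃ n : Fin V.1 → ℤ, (fun x (ε : Vert V.1) => (T ^ vdot n ε) x) ⁻¹' V.2
  have hcont : ∀ (d : ℕ) (n : Fin d → ℤ), Continuous fun x (ε : Vert d) => (T ^ vdot n ε) x :=
    fun d n => continuous_pi fun ε => (T ^ vdot n ε).continuous
  have hU : ∀ V, IsOpen (U V) := fun V => isOpen_iUnion fun n =>
    (TopologicalSpace.isOpen_of_mem_countableBasis V.2.2).preimage (hcont _ n)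
  -- `U V` consists of the points some cube of which meets `V`. Boundaries of open sets are nowhere
  -- dense, so a generic `x` lies in `U V` whenever it lies in its closure.
  obtain ⟨x, hx⟩ := (dense_iInter_of_isOpen (f := fun V => (frontier (U V))ᶜ)
    (fun V => isClosed_frontier.isOpen_compl) (fun V => by
      rw [← interior_eq_empty_iff_dense_compl, ← frontier_compl]
      exact interior_frontier (hU V).isClosed_compl)).nonempty
  rw [mem_iInter] at hx
  refine ⟨x, fun d q hq hqx => ?_⟩
  rw [faceOrbitClosure, (TopologicalSpace.isBasis_countableBasis (Vert d → X)).mem_closure_iff]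
  intro V hV hqV
  have hmem : x ∈ closure (U ⟨d, V, hV⟩) := by
    rw [mem_closure_iff]
    intro W hW hxW
    have hO : IsOpen (V ∩ (fun p : Vert d → X => p fun _ => false) ⁻¹' W) :=
      (TopologicalSpace.isOpen_of_mem_countableBasis hV).inter (hW.preimage (by fun_prop))
    obtain ⟨_, ⟨h1, h2⟩, y, n, rfl⟩ := mem_closure_iff.1 hq _ hO ⟨hqV, by
      rw [mem_preimage, hqx]; exact hxW⟩
    refine ⟨y, by simpa using! h2, mem_iUnion.2 ⟨n, h1⟩⟩
  have hxU : x ∈ U ⟨d, V, hV⟩ := by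
    by_contra hn
    refine hx ⟨d, V, hV⟩ ?_
    rw [(hU _).frontier_eq]
    exact ⟨hmem, hn⟩
  obtain ⟨n, hn⟩ := mem_iUnion.1 hxU
  exact ⟨_, hn, n, rfl⟩

theorem IsGoodBase.const_mem [CompactSpace X] [T2Space X] {T : X ≃ₜ X} {d : ℕ} {x : X}
    (hx : IsGoodBase T d x) (hT : IsMinimalSystem T) {q : Vert d → X}
    (hq : q ∈ parallelepipeds T d) (hqx : q (fun _ => false) = x) :
    (fun _ => x) ∈ faceOrbitClosure T q :=
  const_mem_faceOrbitClosure hT x (hx q hq hqx)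

end GoodBase

/-! ### From regionally proximal pairs to parallelepipeds. -/

section RegionallyProximal

variable {X : Type*} [MetricSpace X] {T : X ≃ₜ X} {d : ℕ}

theorem RP.refl (T : X ≃ₜ X) (d : ℕ) (x : X) : RP T d x x := fun δ hδ =>
  ⟨x, x, 0, by simpa, by simpa, fun ε _ => by simpa⟩

theorem RP.symm {x y : X} (h : RP T d x y) : RP T d y x := fun δ hδ => by
  obtain ⟨x', y', n, h1, h2, h3⟩ := h δ hδ
  exact ⟨y', x', n, h2, h1, fun ε hε => by rw [dist_comm]; exact h3 ε hε⟩

theorem isClosed_RP (T : X ≃ₜ X) (d : ℕ) : IsClosed {p : X × X | RP T d p.1 p.2} := by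
  refine isClosed_of_closure_subset fun p hp δ hδ => ?_
  obtain ⟨q, hq, hpq⟩ := Metric.mem_closure_iff.1 hp (δ / 2) (half_pos hδ)
  obtain ⟨x', y', n, h1, h2, h3⟩ := hq (δ / 2) (half_pos hδ)
  rw [Prod.dist_eq, max_lt_iff] at hpq
  refine ⟨x', y', n, ?_, ?_, fun ε hε => (h3 ε hε).trans (half_lt_self hδ)⟩
  · linarith [dist_triangle p.1 q.1 x', hpq.1]
  · linarith [dist_triangle p.2 q.2 y', hpq.2]

theorem RP.of_mem_orbitClosure [CompactSpace X] {J : Type*} {z z' : J → X} {a b : J}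
    (h : RP T d (z a) (z b)) (hz : z' ∈ orbitClosure (diagHomeo T J) z) :
    RP T d (z' a) (z' b) := by
  have hK : IsClosed ((fun w : J → X => (w a, w b)) ⁻¹' {p : X × X | RP T d p.1 p.2}) :=
    (isClosed_RP T d).preimage (by fun_prop)
  refine orbitClosure_subset (T := diagHomeo T J) hK (fun w hw n => ?_) h hz
  have hw' : RP T d (w a) (w b) := hw
  have := hw'.zpow n
  simpa only [diagHomeo_zpow_apply] using! this

theorem vdot_cons (m : ℤ) (n : Fin d → ℤ) (ε : Vert (d + 1)) :
    vdot (Fin.cons m n : Fin (d + 1) → ℤ) ε = (if ε 0 then m else 0) + vdot n (Fin.tail ε) := by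
  simp only [vdot, Fin.sum_univ_succ, Fin.cons_zero, Fin.cons_succ]
  rfl

/-- The cube of dimension `d + 1` with opposite faces `w` and `v`. -/
def glue (w v : Vert d → X) : Vert (d + 1) → X :=
  fun ε => if ε 0 then v (Fin.tail ε) else w (Fin.tail ε)

theorem continuous_glue : Continuous fun p : (Vert d → X) × (Vert d → X) => glue p.1 p.2 := by
  refine continuous_pi fun ε => ?_
  unfold glue
  split_ifs
  · exact (continuous_apply (Fin.tail ε)).comp continuous_snd
  · exact (continuous_apply (Fin.tail ε)).comp continuous_fst

theorem glue_face_mem {w v : Vert d → X} (h : glue w v ∈ parallelepipeds T (d + 1))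
    (n : Fin d → ℤ) :
    glue (fun ε => (T ^ vdot n ε) (w ε)) (fun ε => (T ^ vdot n ε) (v ε)) ∈
      parallelepipeds T (d + 1) := by
  convert parallelepipeds_face h (Fin.cons 0 n) using 1
  funext ε
  rw [vdot_cons]
  by_cases h0 : ε 0 = true <;> simp [glue, h0]

/-- A regionally proximal pair of order `d` extends to a parallelepiped of dimension `d + 1`
whose two opposite faces differ only in that pair. -/
theorem RP.exists_parallelepiped [CompactSpace X] (hT : IsMinimalSystem T) {x y : X}
    (h : RP T d x y) : ∃ w ∈ parallelepipeds T d, w (fun _ => false) = x ∧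
      glue w (Function.update w (fun _ => false) y) ∈ parallelepipeds T (d + 1) := by
  have key : ∀ δ : ℝ, 0 < δ → ∃ p : (Vert d → X) × (Vert d → X),
      p.1 ∈ parallelepipeds T d ∧ glue p.1 p.2 ∈ parallelepipeds T (d + 1) ∧
      dist (p.1 fun _ => false) x ≤ δ ∧ dist (p.2 fun _ => false) y ≤ 2 * δ ∧
      ∀ ε, ε ≠ (fun _ => false) → dist (p.1 ε) (p.2 ε) ≤ 2 * δ := by
    intro δ hδ
    obtain ⟨x', y', n, h1, h2, h3⟩ := h δ hδ
    have hO : IsOpen (⋂ ε : Vert d, (T ^ vdot n ε) ⁻¹' Metric.ball ((T ^ vdot n ε) y') δ) :=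
      isOpen_iInter_of_finite fun ε => Metric.isOpen_ball.preimage (T ^ vdot n ε).continuous
    -- Minimality replaces y' by a point T^m x' of the orbit of x', close to y' at all times n·ε;
    -- both faces now come from one cube, with `m` as extra direction.
    obtain ⟨_, hm, m, rfl⟩ := mem_closure_iff.1
      (show y' ∈ orbitClosure T x' by rw [hT]; trivial) _ hO
      (mem_iInter.2 fun ε => Metric.mem_ball_self hδ)
    have hm' : ∀ ε, dist ((T ^ vdot n ε) ((T ^ m) x')) ((T ^ vdot n ε) y') < δ :=
      fun ε => mem_iInter.1 hm ε
    refine ⟨(fun ε => (T ^ vdot n ε) x', fun ε => (T ^ vdot n ε) ((T ^ m) x')),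
      cube_mem_parallelepipeds T x' n, ?_, ?_, ?_, fun ε hε => ?_⟩
    · convert cube_mem_parallelepipeds T x' (Fin.cons m n) using 1
      funext ε
      rw [vdot_cons]
      by_cases h0 : ε 0 = true
      · simp [glue, h0, zpow_apply_zpow_apply, add_comm]
      · simp [glue, h0]
    · simpa [dist_comm] using h1.le
    · have := hm' fun _ => false
      simp only [vdot_zero_right, zpow_zero, Homeomorph.one_apply] at this ⊢
      linarith [dist_triangle ((T ^ m) x') y' y, dist_comm y y']
    · have h4 := h3 ε hε
      have h5 := hm' ε
      rw [dist_comm] at h5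
      change dist ((T ^ vdot n ε) x') ((T ^ vdot n ε) ((T ^ m) x')) ≤ _
      linarith [dist_triangle ((T ^ vdot n ε) x') ((T ^ vdot n ε) y')
        ((T ^ vdot n ε) ((T ^ m) x'))]
  choose P hP1 hP2 hP3 hP4 hP5 using fun k : ℕ => key (1 / ((k : ℝ) + 1)) Nat.one_div_pos_of_nat
  obtain ⟨⟨w, v⟩, φ, hφ, hlim⟩ := CompactSpace.tendsto_subseq P
  have hδ : Tendsto (fun k => 1 / ((φ k : ℝ) + 1)) atTop (𝓝 0) :=
    tendsto_one_div_add_atTop_nhds_zero_nat.comp hφ.tendsto_atTop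
  have hδ2 : Tendsto (fun k => 2 * (1 / ((φ k : ℝ) + 1))) atTop (𝓝 0) := by
    simpa using hδ.const_mul 2
  have hw : ∀ ε, Tendsto (fun k => (P (φ k)).1 ε) atTop (𝓝 (w ε)) := fun ε =>
    (((continuous_apply ε).comp continuous_fst).tendsto (w, v)).comp hlim
  have hv : ∀ ε, Tendsto (fun k => (P (φ k)).2 ε) atTop (𝓝 (v ε)) := fun ε =>
    (((continuous_apply ε).comp continuous_snd).tendsto (w, v)).comp hlim
  have hv' : Function.update w (fun _ => false) y = v := by
    funext ε
    by_cases hε : ε = fun _ => false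
    · subst hε
      rw [Function.update_self, ← dist_le_zero, dist_comm]
      exact le_of_tendsto_of_tendsto' ((hv _).dist tendsto_const_nhds) hδ2 fun k => hP4 (φ k)
    · rw [Function.update_of_ne hε, ← dist_le_zero]
      exact le_of_tendsto_of_tendsto' ((hw ε).dist (hv ε)) hδ2 fun k => hP5 (φ k) ε hε
  refine ⟨w, ?_, ?_, ?_⟩
  · exact isClosed_parallelepipeds.mem_of_tendsto ((continuous_fst.tendsto (w, v)).comp hlim)
      (Eventually.of_forall fun k => hP1 (φ k))
  · rw [← dist_le_zero]
    exact le_of_tendsto_of_tendsto' ((hw _).dist tendsto_const_nhds) hδ fun k => hP3 (φ k)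
  · rw [hv']
    exact isClosed_parallelepipeds.mem_of_tendsto ((continuous_glue.tendsto (w, v)).comp hlim)
      (Eventually.of_forall fun k => hP2 (φ k))

/-- Over a good base point a regionally proximal pair gives a parallelepiped that is constant
except at one vertex. -/
theorem RP.update_const_mem [CompactSpace X] (hT : IsMinimalSystem T) {x y : X}
    (hx : IsGoodBase T d x) (h : RP T d x y) :
    Function.update (fun _ => x) (fun _ => false) y ∈ parallelepipeds T (d + 1) := by
  obtain ⟨w, hw, hwx, hwy⟩ := h.exists_parallelepiped hT
  have h1 : glue (fun _ => x) (Function.update (fun _ => x) (fun _ => false) y) ∈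
      parallelepipeds T (d + 1) := by
    -- Face transformations in the last `d` directions act alike on both faces and fix the entries x
    -- and y; apply those that carry w towards the constant cube.
    refine isClosed_parallelepipeds.closure_subset (map_mem_closure
      (f := fun s : Vert d → X => glue s (Function.update s (fun _ => false) y))
      (continuous_glue.comp (continuous_id.prodMk (continuous_id.update _ continuous_const)))
      (hx.const_mem hT hw hwx) ?_)
    rintro _ ⟨n, rfl⟩
    convert glue_face_mem hwy n using 2
    funext ε
    by_cases hε : ε = fun _ => false
    · subst hε; simp
    · simp [Function.update_of_ne hε]
  -- In `h1` the entry y sits at (1, 0, ..., 0); this reflection brings it to 0.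
  convert parallelepipeds_xor h1 (Fin.cons true fun _ => false) using 1
  funext ε
  by_cases h0 : ε = fun _ => false
  · subst h0
    simp [glue, Function.update_self]
  · rw [Function.update_of_ne h0]
    by_cases h00 : ε 0 = true
    · simp [glue, h00]
    · have : Fin.tail (fun i => xor (ε i)
          ((Fin.cons true fun _ => false : Vert (d + 1)) i)) ≠ fun _ => false := by
        intro hc
        refine h0 (funext fun i => ?_)
        refine Fin.cases (by simpa using h00) (fun j => ?_) i
        simpa [Fin.tail] using congrFun hc j
      simp [glue, h00, Function.update_of_ne this]

/-- Over a good base point the vertex `0` of a parallelepiped can be moved along a regionally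
proximal pair. -/
theorem RP.update_zero_mem [CompactSpace X] (hT : IsMinimalSystem T) {x y : X}
    (hx : IsGoodBase T d x) (hx' : IsGoodBase T (d + 1) x) (h : RP T d x y)
    {q : Vert (d + 1) → X} (hq : q ∈ parallelepipeds T (d + 1)) (hqx : q (fun _ => false) = x) :
    Function.update q (fun _ => false) y ∈ parallelepipeds T (d + 1) := by
  refine isClosed_parallelepipeds.closure_subset (map_mem_closure
    (f := fun s : Vert (d + 1) → X => Function.update s (fun _ => false) y)
    (continuous_id.update _ continuous_const) (hx' q hq hqx) ?_)
  rintro _ ⟨n, rfl⟩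
  convert parallelepipeds_face (h.update_const_mem hT hx) n using 1
  funext ε
  by_cases hε : ε = fun _ => false
  · subst hε; simp
  · simp [Function.update_of_ne hε]

end RegionallyProximal

/-! ### Changing vertices along minimal points of powers. -/

section MinimalCubes

variable {X : Type*} [MetricSpace X] {T : X ≃ₜ X} {d : ℕ}

theorem parallelepipeds_of_mem_orbitClosure {J : Type*} {z z' : J → X} {i : Vert d → J}
    (h : z ∘ i ∈ parallelepipeds T d) (hz : z' ∈ orbitClosure (diagHomeo T J) z) :
    z' ∘ i ∈ parallelepipeds T d := by
  have hK : IsClosed ((fun w : J → X => w ∘ i) ⁻¹' parallelepipeds T d) :=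
    isClosed_parallelepipeds.preimage (by fun_prop)
  refine orbitClosure_subset (T := diagHomeo T J) hK (fun w hw n => ?_) h hz
  have := parallelepipeds_diag hw n
  simpa only [diagHomeo_zpow_apply] using! this

/-- Fibres of the quotient are classes of the generated equivalence relation, so chains stand in for
transitivity of RP. The chain is continued past `k` to be indexed by all of ℕ. -/
theorem exists_chain_of_eqvGen {x y : X} (h : Relation.EqvGen (RP T d) x y) :
    ∃ (k : ℕ) (c : ℕ → X), c 0 = x ∧ c k = y ∧ ∀ j, RP T d (c j) (c (j + 1)) := by
  have hr : Relation.ReflTransGen (RP T d) x y := by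
    induction h with
    | rel x y h => exact .single h
    | refl x => exact .refl
    | symm x y _ ih =>
      have : Std.Symm (RP T d) := ⟨fun _ _ => RP.symm⟩
      exact Std.Symm.symm _ _ ih
    | trans x y z _ _ ih1 ih2 => exact ih1.trans ih2
  clear h
  induction hr using Relation.ReflTransGen.head_induction_on with
  | refl => exact ⟨0, fun _ => y, rfl, rfl, fun _ => RP.refl T d y⟩
  | head hab _ ih =>
    rename_i a b _
    obtain ⟨k, c, h0, hk, hc⟩ := ih
    refine ⟨k + 1, fun j => Nat.casesOn j a c, rfl, hk, fun j => ?_⟩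
    cases j with
    | zero =>
      change RP T d a (c 0)
      rwa [h0]
    | succ j => exact hc j

variable [CompactSpace X]

/-- One vertex of a parallelepiped, all of whose entries are coordinates of a minimal point, can be
moved along a regionally proximal pair of coordinates. -/
theorem RP.comp_update_mem (hT : IsMinimalSystem T) {J : Type*} {z : J → X}
    (hz : IsMinimalPoint (diagHomeo T J) z) {i : Vert (d + 1) → J} {ω : Vert (d + 1)} {b : J}
    (h : RP T d (z (i ω)) (z b)) (hi : z ∘ i ∈ parallelepipeds T (d + 1)) :
    z ∘ Function.update i ω b ∈ parallelepipeds T (d + 1) := by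
  have : Nonempty X := ⟨z b⟩
  obtain ⟨x, hx⟩ := exists_isGoodBase T
  obtain ⟨z', hz', hzx⟩ := exists_mem_orbitClosure_apply (T := T) z (i ω) (x := x)
    (by rw [hT]; trivial)
  have h' : RP T d x (z' b) := hzx ▸ h.of_mem_orbitClosure hz'
  have hq := parallelepipeds_xor (parallelepipeds_of_mem_orbitClosure hi hz') ω
  have h2 := parallelepipeds_xor
    (h'.update_zero_mem hT (hx d) (hx (d + 1)) hq (by simpa using hzx)) ω
  -- The vertex was changed over `z'`; minimality of `z` allows the return.
  refine parallelepipeds_of_mem_orbitClosure ?_ (hz.mem_symm hz')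
  convert h2 using 1
  funext ε
  by_cases hε : ε = ω
  · subst hε; simp
  · have := (xor_eq_zero_iff ε ω).not.2 hε
    rw [Function.update_of_ne this]
    simp [Function.update_of_ne hε]

/-- The intermediate points of a chain need not be coordinates of `z`. They are adjoined as new
coordinates and replaced so that the whole is minimal over the same `z`; RP relations and equalities
between coordinates survive in the orbit closure, so the one-pair move can be iterated. -/
theorem comp_update_mem_of_eqvGen (hT : IsMinimalSystem T) {J : Type*} {z : J → X}
    (hz : IsMinimalPoint (diagHomeo T J) z) {i : Vert (d + 1) → J} {ω : Vert (d + 1)} {b : J}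
    (h : Relation.EqvGen (RP T d) (z (i ω)) (z b)) (hi : z ∘ i ∈ parallelepipeds T (d + 1)) :
    z ∘ Function.update i ω b ∈ parallelepipeds T (d + 1) := by
  obtain ⟨k, c, h0, hk, hc⟩ := exists_chain_of_eqvGen h
  obtain ⟨w, hw, hwmin, rfl⟩ := exists_isMinimalPoint_sumElim hz c
  have hchain : ∀ j, RP T d (w (Sum.inr j)) (w (Sum.inr (j + 1))) := fun j =>
    RP.of_mem_orbitClosure (a := Sum.inr j) (b := Sum.inr (j + 1)) (hc j) hw
  have heq : ∀ a b : J ⊕ ℕ, Sum.elim (w ∘ Sum.inl) c a = Sum.elim (w ∘ Sum.inl) c b →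
      w a = w b := fun a b hab => by
    have hK : IsClosed {v : J ⊕ ℕ → X | v a = v b} :=
      isClosed_eq (continuous_apply a) (continuous_apply b)
    refine orbitClosure_subset (T := diagHomeo T (J ⊕ ℕ)) hK (fun v hv n => ?_) hab hw
    have hv' : v a = v b := hv
    change (diagHomeo T (J ⊕ ℕ) ^ n) v a = (diagHomeo T (J ⊕ ℕ) ^ n) v b
    simp only [diagHomeo_zpow_apply, hv']
  have hstep : ∀ j, w ∘ Function.update (Sum.inl ∘ i) ω (Sum.inr j) ∈
      parallelepipeds T (d + 1) := fun j => by
    induction j with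
    | zero =>
      convert hi using 1
      funext ε
      by_cases hε : ε = ω
      · subst hε
        simpa using heq (Sum.inr 0) (Sum.inl (i ε)) h0
      · simp [Function.update_of_ne hε]
    | succ j ih =>
      have := RP.comp_update_mem hT hwmin (ω := ω) (b := Sum.inr (j + 1))
        (by simpa using hchain j) ih
      simpa using this
  convert hstep k using 1
  funext ε
  by_cases hε : ε = ω
  · subst hε
    simpa using heq (Sum.inl b) (Sum.inr k) hk.symm
  · simp [Function.update_of_ne hε]

/-- A minimal point of `X ^ J` with all coordinates in one fibre of the maximal `d`-step factor
yields only parallelepipeds of dimension `d + 1`. -/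
theorem comp_mem_parallelepipeds_of_isMinimalPoint (hT : IsMinimalSystem T) {J : Type*}
    {z : J → X} (hz : IsMinimalPoint (diagHomeo T J) z)
    (h : ∀ a b, proNilMap T d (z a) = proNilMap T d (z b)) (i : Vert (d + 1) → J) :
    z ∘ i ∈ parallelepipeds T (d + 1) := by
  classical
  have key : ∀ s : Finset (Vert (d + 1)),
      (z ∘ fun ε => if ε ∈ s then i ε else i fun _ => false) ∈ parallelepipeds T (d + 1) :=
    fun s => by
    induction s using Finset.induction_on with
    | empty => simpa using! const_mem_parallelepipeds T (z (i fun _ => false))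
    | insert ω s _ ih =>
      have := comp_update_mem_of_eqvGen hT hz (ω := ω) (b := i ω) (Quot.eqvGen_exact (h _ _)) ih
      convert this using 2
      funext ε
      by_cases hε : ε = ω
      · subst hε; simp
      · simp [hε]
  simpa using! key Finset.univ

end MinimalCubes

/-! ### Descent to the factor and conclusion. -/

section Factor

variable {X : Type*} [MetricSpace X] [CompactSpace X] {d : ℕ}

theorem proNilMap_zpow (T : X ≃ₜ X) (n : ℤ) (x : X) :
    proNilMap T d ((T ^ n) x) = (proNilHomeo T d ^ n) (proNilMap T d x) := by
  induction n using Int.induction_on generalizing x with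
  | zero => rfl
  | succ k ih => rw [zpow_add, zpow_add, Homeomorph.mul_apply, Homeomorph.mul_apply, ih]; rfl
  | pred k ih =>
    rw [sub_eq_add_neg, zpow_add, zpow_add, Homeomorph.mul_apply, Homeomorph.mul_apply, ih]; rfl

/-- Density of minimal points in the fibre power indexed by the vertices, together with closedness
of Q, reduces this to minimal points. -/
theorem fibre_mem_parallelepipeds {T : X ≃ₜ X} (hT : IsMinimalSystem T)
    (hRIC : IsRIC T (proNilMap T d)) {p : Vert (d + 1) → X}
    (hp : ∀ ε ω, proNilMap T d (p ε) = proNilMap T d (p ω)) :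
    p ∈ parallelepipeds T (d + 1) := by
  let e := Fintype.equivFin (Vert (d + 1))
  have h1 : p ∘ e.symm ∈ fibreRel (proNilMap T d) (Fintype.card (Vert (d + 1))) :=
    fun i j => hp _ _
  have h2 := hRIC.dense_minimal _ Fintype.card_pos h1
  have h3 : (p ∘ e.symm) ∘ e ∈ closure (parallelepipeds T (d + 1)) :=
    map_mem_closure (f := fun z : Fin (Fintype.card (Vert (d + 1))) → X => z ∘ e) (by fun_prop) h2
      fun z hz => comp_mem_parallelepipeds_of_isMinimalPoint hT hz.2 hz.1 e
  rw [isClosed_parallelepipeds.closure_eq] at h3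
  simpa [Function.comp_assoc] using h3

/-- The dimension-shifted form of the theorem. -/
theorem parallelepipeds_eq_preimage {T : X ≃ₜ X} (hT : IsMinimalSystem T)
    (hRIC : IsRIC T (proNilMap T d)) :
    parallelepipeds T (d + 1) =
      cubeMap (proNilMap T d) (d + 1) ⁻¹' parallelepipeds (proNilHomeo T d) (d + 1) := by
  have hπ := proNilMap_isFactorMap T d
  have hcont : Continuous (cubeMap (proNilMap T d) (d + 1)) :=
    continuous_pi fun ε => hπ.1.comp (continuous_apply ε)
  have hopen : IsOpenMap (cubeMap (proNilMap T d) (d + 1)) :=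
    IsOpenMap.piMap (fun _ => hRIC.isOpenMap) (by simp)
  apply Subset.antisymm
  · intro p hp
    refine map_mem_closure hcont hp ?_
    rintro _ ⟨x, n, rfl⟩
    exact ⟨proNilMap T d x, n, funext fun ε => proNilMap_zpow T _ x⟩
  · rw [parallelepipeds, hopen.preimage_closure_eq_closure_preimage hcont]
    refine closure_minimal ?_ isClosed_parallelepipeds
    rintro p ⟨y, n, hp⟩
    -- Undoing the face transformation `n` puts all vertices in the fibre over `y`.
    have h1 : ∀ ε, proNilMap T d ((T ^ (-vdot n ε)) (p ε)) = y := fun ε => by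
      have : proNilMap T d (p ε) = (proNilHomeo T d ^ vdot n ε) y := congrFun hp ε
      rw [proNilMap_zpow, this, zpow_apply_zpow_apply]
      simp
    have h2 := fibre_mem_parallelepipeds hT hRIC (p := fun ε => (T ^ (-vdot n ε)) (p ε))
      fun ε ω => (h1 ε).trans (h1 ω).symm
    simpa [zpow_apply_zpow_apply] using parallelepipeds_face h2 n

end Factor

end CubeDyn

theorem proposition3 {X : Type*} [MetricSpace X] [CompactSpace X] (T : X ≃ₜ X)
    (hT : CubeDyn.IsMinimalSystem T) (d : ℕ) (hd : 1 ≤ d)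
    (hRIC : CubeDyn.IsRIC T (CubeDyn.proNilMap T (d - 1))) :
    CubeDyn.parallelepipeds T d =
      CubeDyn.cubeMap (CubeDyn.proNilMap T (d - 1)) d ⁻¹'
        CubeDyn.parallelepipeds (CubeDyn.proNilHomeo T (d - 1)) d := by
  obtain ⟨e, rfl⟩ := Nat.exists_eq_add_of_le' hd
  exact CubeDyn.parallelepipeds_eq_preimage hT hRIC
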